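/- Fix an infinite set $\mathsf{Prop}$ of propositional variables and consider formulas in the language $(\wedge,\vee,\to,0,1)$. A \emph{$\Pi_2$-rule} is a triple $(\Gamma,\psi,F)$, written $\tilde\forall\bar p\,\Gamma/^2\psi$ with $F=\{\bar p\}$, where $\Gamma$ is a finite set of formulas, $\psi$ is a formula, and $F$ is a finite set of variables not occurring in $\psi$; a variable of $\Gamma$ outside $F$ is called free in $\Gamma$. If $F=\emptyset$ it is a \emph{$\Pi_1$-rule} $\Gamma/\psi$. A set $\vdash$ of $\Pi_2$-rules is a \emph{$\Pi_2$-rule system} if it satisfies the following conditions, in which all triples are required to be $\Pi_2$-rules: \begin{itemize} \item (Strong reflexivity) $\tilde\forall\bar p\,\Gamma\vdash\chi[\bar\phi/\bar p]$ whenever $\chi\in\Gamma$ and the formulas $\bar\phi$ contain no variable from $\bar p$. \item (Monotonicity) If $\tilde\forall\bar p\,\Gamma\vdash\psi$ and $\Gamma'$ is a finite set of formulas, then $\tilde\forall\bar p\,(\Gamma\cup\Gamma')\vdash\psi$. \item ($\alpha$-renaming) If $\tilde\forall\bar p\,\Gamma\vdash\psi$, then $\tilde\forall\bar q\,\Gamma[\bar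 q/\bar p]\vdash\psi$ for every tuple $\bar q$ of distinct variables none of which is free in $\Gamma$ or occurs in $\psi$. \item (Rule cut) If $\tilde\forall\bar p\,\Gamma\vdash\mu$ for each $\mu\in\Delta$ and $\tilde\forall\bar q\,\Delta\vdash\psi$, where $\Gamma$ contains no variable from $\bar q$ and $\psi$ contains no variable from $\bar p$ or $\bar q$, then $\tilde\forall\bar p\,\Gamma\vdash\psi$. \item (Bound structurality) If $\tilde\forall\bar p\,\Gamma\vdash\psi$ and $\sigma$ is a substitution that fixes every variable in $\bar p$ and is such that no variable in $\bar p$ occurs in $\sigma(\psi)$ or in $\sigma(q)$ for any $q$ free in $\Gamma$, then $\tilde\forall\bar p\,\sigma[\Gamma]\vdash\sigma(\psi)$. \end{itemize} For sets $L,\Sigma$ of $\Pi_2$-rules, let $L\oplus\Sigma$ be the smallest $\Pi_2$-rule system containing $L\cup\Sigma$. Let $\mathsf{IPC}$ be intuitionistic propositional logic, regarded as the collection of $\Pi_1$-rules consisting of the axioms of a standard Hilbert calculus and modus ponens, and let $\mathsf{LC}=\mathsf{IPC}\oplus (p\to q)\vee(q\to p)$ be the G\"odel--Dummett logic. A $\Pi_2$-rule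 $\rho$ is \emph{admissible} over $\mathsf{LC}$ if, for every formula $\chi$, $\vdash_{\mathsf{LC}\oplus\rho}\chi$ implies $\vdash_{\mathsf{LC}}\chi$. It is \emph{hereditarily admissible} over $\mathsf{LC}$ if, for every $\Pi_1$-rule $\Delta/\psi$, $\Delta\vdash_{\mathsf{LC}\oplus\rho}\psi$ implies $\Delta\vdash_{\mathsf{LC}}\psi$. \textbf{Corollary.} A $\Pi_2$-rule is admissible over $\mathsf{LC}$ if and only if it is hereditarily admissible over $\mathsf{LC}$. -/

import Mathlib

namespace PiTwo

/-- Formulas of the intuitionistic language `(∧, ∨, →, 0, 1)` over a set `α` of propositional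
variables. -/
inductive Formula (α : Type*) : Type _
  | var : α → Formula α
  | bot : Formula α
  | top : Formula α
  | and : Formula α → Formula α → Formula α
  | or : Formula α → Formula α → Formula α
  | imp : Formula α → Formula α → Formula α

namespace Formula

variable {α : Type*}

/-- The variables occurring in a formula. -/
def vars : Formula α → Set α
  | var x => {x}
  | bot => ∅
  | top => ∅
  | and φ ψ => φ.vars ∪ ψ.vars
  | or φ ψ => φ.vars ∪ ψ.vars
  | imp φ ψ => φ.vars ∪ ψ.vars

/-- Uniform (simultaneous) substitution. -/
def subst (σ : α → Formula α) : Formula α → Formula α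
  | var x => σ x
  | bot => bot
  | top => top
  | and φ ψ => and (φ.subst σ) (ψ.subst σ)
  | or φ ψ => or (φ.subst σ) (ψ.subst σ)
  | imp φ ψ => imp (φ.subst σ) (ψ.subst σ)

end Formula

/-- A `Π₂`-rule `(Γ, ψ, F)`: a finite set `Γ` of premises, a conclusion `ψ`, and a finite set `F`
of variables (the bound context) not occurring in `ψ`. -/
@[ext]
structure Rule (α : Type*) where
  premises : Set (Formula α)
  conclusion : Formula α
  bound : Set α
  finite_premises : premises.Finite
  finite_bound : bound.Finite
  bound_fresh : Disjoint bound conclusion.vars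

namespace Rule

variable {α : Type*}

/-- The variables occurring free in the premises: those outside the bound context. -/
def freeVars (r : Rule α) : Set α :=
  {x | x ∉ r.bound ∧ ∃ φ ∈ r.premises, x ∈ φ.vars}

/-- The `Π₁`-rule `Δ / ψ`: the bound context is empty. -/
def pi1 (Δ : Set (Formula α)) (hΔ : Δ.Finite) (ψ : Formula α) : Rule α where
  premises := Δ
  conclusion := ψ
  bound := ∅
  finite_premises := hΔ
  finite_bound := Set.finite_empty
  bound_fresh := Set.empty_disjoint _

/-- The rule `∅ / χ` with empty bound context; it belongs to a system iff `χ` is a theorem. -/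
def thm (χ : Formula α) : Rule α :=
  pi1 ∅ Set.finite_empty χ

end Rule

/-- `Π₂`-rule systems. In each clause the rule that has to belong to the system is a variable `r'`
whose components are prescribed; that `r'` is a rule (finiteness, and the bound variables do not
occur in the conclusion) is thus a side condition of the clause. -/
structure IsRuleSystem {α : Type*} (S : Set (Rule α)) : Prop where
  /-- `∀p̄ Γ ⊢ χ[φ̄/p̄]` for `χ ∈ Γ` and formulas `φ̄` without variables from `p̄`. -/
  strong_reflexivity : ∀ (r' : Rule α) (σ : α → Formula α), ∀ χ ∈ r'.premises,
    (∀ x ∉ r'.bound, σ x = Formula.var x) →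
    (∀ x ∈ r'.bound, Disjoint r'.bound (σ x).vars) →
    r'.conclusion = χ.subst σ →
    r' ∈ S
  /-- From `∀p̄ Γ ⊢ ψ` to `∀p̄ (Γ, Γ') ⊢ ψ`. -/
  monotonicity : ∀ r ∈ S, ∀ r' : Rule α,
    r.premises ⊆ r'.premises →
    r'.bound = r.bound →
    r'.conclusion = r.conclusion →
    r' ∈ S
  /-- From `∀p̄ Γ ⊢ ψ` to `∀q̄ Γ[q̄/p̄] ⊢ ψ`, where `q̄` is a tuple of distinct variables that do not
  occur free in `Γ` or in `ψ`; the renaming of `p̄` to `q̄` is `f`. -/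
  alpha_renaming : ∀ r ∈ S, ∀ (f : α → α) (r' : Rule α),
    (∀ x ∉ r.bound, f x = x) →
    Set.InjOn f r.bound →
    (∀ x ∈ r.bound, f x ∉ r.freeVars ∧ f x ∉ r.conclusion.vars) →
    r'.bound = f '' r.bound →
    r'.premises = Formula.subst (fun x => Formula.var (f x)) '' r.premises →
    r'.conclusion = r.conclusion →
    r' ∈ S
  /-- From `∀q̄ Δ ⊢ ψ` (the rule `r`) and `∀p̄ Γ ⊢ μ` for all `μ ∈ Δ` to `∀p̄ Γ ⊢ ψ` (the rule `r'`),
  where `Γ` contains no variable from `q̄`. -/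
  rule_cut : ∀ r ∈ S, ∀ r' : Rule α,
    (∀ μ ∈ r.premises, ∃ s ∈ S,
      s.premises = r'.premises ∧ s.bound = r'.bound ∧ s.conclusion = μ) →
    (∀ φ ∈ r'.premises, Disjoint r.bound φ.vars) →
    r'.conclusion = r.conclusion →
    r' ∈ S
  /-- From `∀p̄ Γ ⊢ ψ` to `∀p̄ σ[Γ] ⊢ σ(ψ)`, where `σ` fixes `p̄` and no variable from `p̄` occurs in
  `σ(q)` for `q` free in `Γ` (nor, `r'` being a rule, in `σ(ψ)`). -/
  bound_structurality : ∀ r ∈ S, ∀ (σ : α → Formula α) (r' : Rule α),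
    (∀ x ∈ r.bound, σ x = Formula.var x) →
    (∀ y ∈ r.freeVars, Disjoint r.bound (σ y).vars) →
    r'.bound = r.bound →
    r'.premises = Formula.subst σ '' r.premises →
    r'.conclusion = r.conclusion.subst σ →
    r' ∈ S

section

variable {α : Type*}

/-- `L ⊕ R`: the smallest `Π₂`-rule system extending `L` and containing the rules in `R`. -/
def oplus (L R : Set (Rule α)) : Set (Rule α) :=
  ⋂₀ {S | IsRuleSystem S ∧ L ⊆ S ∧ R ⊆ S}

open Formula in
/-- A standard Hilbert calculus for intuitionistic propositional logic, as a collection of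
`Π₁`-rules: the axiom schemes and modus ponens. -/
inductive IPC : Set (Rule α)
  | imp_intro (φ ψ : Formula α) : IPC (Rule.thm (imp φ (imp ψ φ)))
  | imp_distrib (φ ψ χ : Formula α) :
      IPC (Rule.thm (imp (imp φ (imp ψ χ)) (imp (imp φ ψ) (imp φ χ))))
  | and_left (φ ψ : Formula α) : IPC (Rule.thm (imp (and φ ψ) φ))
  | and_right (φ ψ : Formula α) : IPC (Rule.thm (imp (and φ ψ) ψ))
  | and_intro (φ ψ : Formula α) : IPC (Rule.thm (imp φ (imp ψ (and φ ψ))))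
  | or_inl (φ ψ : Formula α) : IPC (Rule.thm (imp φ (or φ ψ)))
  | or_inr (φ ψ : Formula α) : IPC (Rule.thm (imp ψ (or φ ψ)))
  | or_elim (φ ψ χ : Formula α) :
      IPC (Rule.thm (imp (imp φ χ) (imp (imp ψ χ) (imp (or φ ψ) χ))))
  | bot_elim (φ : Formula α) : IPC (Rule.thm (imp bot φ))
  | top_intro : IPC (Rule.thm top)
  | modus_ponens (φ ψ : Formula α) :
      IPC (Rule.pi1 {φ, imp φ ψ} (Set.toFinite _) ψ)

/-- The Gödel–Dummett logic `LC = IPC ⊕ (p → q) ∨ (q → p)`. -/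
def LC : Set (Rule α) :=
  oplus IPC {r | ∃ p q : α,
    r = Rule.thm (.or (.imp (.var p) (.var q)) (.imp (.var q) (.var p)))}

/-- `ρ` is admissible in `S`: adding `ρ` to `S` yields no new theorems. -/
def Admissible (S : Set (Rule α)) (ρ : Rule α) : Prop :=
  ∀ χ : Formula α, Rule.thm χ ∈ oplus S {ρ} → Rule.thm χ ∈ S

/-- `ρ` is hereditarily admissible in `S`: adding `ρ` to `S` yields no new `Π₁`-rules. -/
def HereditarilyAdmissible (S : Set (Rule α)) (ρ : Rule α) : Prop :=
  ∀ (Δ : Set (Formula α)) (hΔ : Δ.Finite) (ψ : Formula α),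
    Rule.pi1 Δ hΔ ψ ∈ oplus S {ρ} → Rule.pi1 Δ hΔ ψ ∈ S

end

end PiTwo

namespace PiTwo

open Formula

variable {α : Type*}

/-! The substance is structural completeness of Gödel–Dummett logic (`pi1_mem_LC_of_forall_subst`).
Suppose Δ / ψ lies in LC ⊕ ρ and σ turns Δ into theorems of LC. Structurality and cut make σ(ψ) a
theorem of LC ⊕ ρ, so admissibility makes it one of LC; structural completeness then puts Δ / ψ in
LC. No analysis of derivations using ρ is needed. The converse is the case Δ = ∅.

For structural completeness, let φ be the conjunction of Δ. If φ is classically unsatisfiable, it is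
refutable (Glivenko) and Δ / ψ holds by explosion. Otherwise a valuation of φ yields a projective
unifier σ: it makes every member of Δ a theorem, and σ(ψ) is equivalent to ψ given φ, so the theorem
σ(ψ) yields ψ from Δ. -/

theorem isRuleSystem_oplus (L R : Set (Rule α)) : IsRuleSystem (oplus L R) where
  strong_reflexivity r' σ χ hχ h₁ h₂ h₃ S hS := hS.1.strong_reflexivity r' σ χ hχ h₁ h₂ h₃
  monotonicity r hr r' h₁ h₂ h₃ S hS := hS.1.monotonicity r (hr S hS) r' h₁ h₂ h₃
  alpha_renaming r hr f r' h₁ h₂ h₃ h₄ h₅ h₆ S hS :=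
    hS.1.alpha_renaming r (hr S hS) f r' h₁ h₂ h₃ h₄ h₅ h₆
  rule_cut r hr r' h₁ h₂ h₃ S hS := by
    refine hS.1.rule_cut r (hr S hS) r' (fun μ hμ => ?_) h₂ h₃
    obtain ⟨s, hs, h⟩ := h₁ μ hμ
    exact ⟨s, hs S hS, h⟩
  bound_structurality r hr σ r' h₁ h₂ h₃ h₄ h₅ S hS :=
    hS.1.bound_structurality r (hr S hS) σ r' h₁ h₂ h₃ h₄ h₅

theorem subset_oplus_left (L R : Set (Rule α)) : L ⊆ oplus L R :=
  fun _ hr _ hS => hS.2.1 hr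

theorem subset_oplus_right (L R : Set (Rule α)) : R ⊆ oplus L R :=
  fun _ hr _ hS => hS.2.2 hr

/-! ### Closure properties of Π₁-rules -/

namespace IsRuleSystem

variable {S : Set (Rule α)}

theorem pi1_of_mem (hS : IsRuleSystem S) {Δ : Set (Formula α)} (hΔ : Δ.Finite) {χ : Formula α}
    (hχ : χ ∈ Δ) : Rule.pi1 Δ hΔ χ ∈ S := by
  have hid : ∀ φ : Formula α, φ.subst var = φ := by
    intro φ
    induction φ <;> simp_all [subst]
  exact hS.strong_reflexivity _ var χ hχ (fun _ _ => rfl) (fun _ h => h.elim) (hid χ).symm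

theorem pi1_of_thm (hS : IsRuleSystem S) {Δ : Set (Formula α)} (hΔ : Δ.Finite) {χ : Formula α}
    (h : Rule.thm χ ∈ S) : Rule.pi1 Δ hΔ χ ∈ S :=
  hS.monotonicity _ h _ (Set.empty_subset _) rfl rfl

theorem pi1_cut (hS : IsRuleSystem S) {Γ Δ : Set (Formula α)} (hΓ : Γ.Finite) (hΔ : Δ.Finite)
    {χ : Formula α} (h : Rule.pi1 Δ hΔ χ ∈ S) (hcut : ∀ μ ∈ Δ, Rule.pi1 Γ hΓ μ ∈ S) :
    Rule.pi1 Γ hΓ χ ∈ S :=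
  hS.rule_cut _ h _ (fun μ hμ => ⟨_, hcut μ hμ, rfl, rfl, rfl⟩)
    (fun _ _ => Set.empty_disjoint _) rfl

theorem pi1_subst (hS : IsRuleSystem S) {Δ : Set (Formula α)} (hΔ : Δ.Finite) {χ : Formula α}
    (h : Rule.pi1 Δ hΔ χ ∈ S) (σ : α → Formula α) :
    Rule.pi1 (subst σ '' Δ) (hΔ.image _) (χ.subst σ) ∈ S :=
  hS.bound_structurality _ h σ _ (fun _ h => h.elim) (fun _ _ => Set.empty_disjoint _) rfl rfl rfl

end IsRuleSystem

theorem isRuleSystem_LC : IsRuleSystem (LC : Set (Rule α)) := isRuleSystem_oplus _ _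

/-- The rule system `LC` contains every instance of the linearity axiom. -/
theorem thm_linearity_mem_LC [Nontrivial α] (φ ψ : Formula α) :
    Rule.thm (or (imp φ ψ) (imp ψ φ)) ∈ (LC : Set (Rule α)) := by
  classical
  obtain ⟨p, q, hpq⟩ := exists_pair_ne α
  have h : Rule.thm (or (imp (var p) (var q)) (imp (var q) (var p))) ∈ (LC : Set (Rule α)) :=
    subset_oplus_right _ _ ⟨p, q, rfl⟩
  -- Distinctness of `p` and `q` allows them to be replaced independently.
  have h' := isRuleSystem_LC.pi1_subst Set.finite_empty h (fun x => if x = p then φ else ψ)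
  simpa [subst, hpq.symm, Rule.thm] using h'

theorem pi1_mp_mem_LC {Δ : Set (Formula α)} (hΔ : Δ.Finite) {φ ψ : Formula α}
    (h : Rule.pi1 Δ hΔ (imp φ ψ) ∈ LC) (h' : Rule.pi1 Δ hΔ φ ∈ LC) :
    Rule.pi1 Δ hΔ ψ ∈ LC := by
  refine isRuleSystem_LC.pi1_cut hΔ _ (subset_oplus_left _ _ (IPC.modus_ponens φ ψ)) ?_
  rintro μ (rfl | rfl)
  · exact h'
  · exact h

/-- Hilbert-style derivability in Gödel–Dummett logic from a set of hypotheses. -/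
inductive Prov (Γ : Set (Formula α)) : Formula α → Prop
  | hyp {φ : Formula α} : φ ∈ Γ → Prov Γ φ
  | ax {φ : Formula α} : Rule.thm φ ∈ IPC → Prov Γ φ
  | linearity (φ ψ : Formula α) : Prov Γ (or (imp φ ψ) (imp ψ φ))
  | mp {φ ψ : Formula α} : Prov Γ (imp φ ψ) → Prov Γ φ → Prov Γ ψ

/-! ### Derivations in the Hilbert calculus -/

namespace Prov

variable {Γ Γ' : Set (Formula α)} {φ ψ χ φ' ψ' : Formula α}

/-- Only this soundness direction is needed: the calculus serves to produce members of `LC`. -/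
theorem pi1_mem_LC [Nontrivial α] (hΓ : Γ.Finite) (h : Prov Γ φ) : Rule.pi1 Γ hΓ φ ∈ LC := by
  induction h with
  | hyp h => exact isRuleSystem_LC.pi1_of_mem hΓ h
  | ax h => exact isRuleSystem_LC.pi1_of_thm hΓ (subset_oplus_left _ _ h)
  | linearity φ ψ => exact isRuleSystem_LC.pi1_of_thm hΓ (thm_linearity_mem_LC φ ψ)
  | mp _ _ ih₁ ih₂ => exact pi1_mp_mem_LC hΓ ih₁ ih₂

theorem mono (h : Prov Γ φ) (hΓ : Γ ⊆ Γ') : Prov Γ' φ := by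
  induction h with
  | hyp h => exact hyp (hΓ h)
  | ax h => exact ax h
  | linearity φ ψ => exact linearity φ ψ
  | mp _ _ ih₁ ih₂ => exact mp ih₁ ih₂

theorem weaken (h : Prov Γ φ) : Prov (insert χ Γ) φ := h.mono (Set.subset_insert _ _)

theorem head : Prov (insert φ Γ) φ := hyp (Set.mem_insert _ _)

theorem const (h : Prov Γ ψ) : Prov Γ (imp φ ψ) := mp (ax (IPC.imp_intro ψ φ)) h

theorem imp_self : Prov Γ (imp φ φ) :=
  mp (mp (ax (IPC.imp_distrib φ (imp φ φ) φ)) (ax (IPC.imp_intro φ (imp φ φ))))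
    (ax (IPC.imp_intro φ φ))

/-- The deduction theorem. -/
theorem ded (h : Prov (insert φ Γ) ψ) : Prov Γ (imp φ ψ) := by
  induction h with
  | hyp h =>
    rcases h with rfl | h
    · exact imp_self
    · exact const (hyp h)
  | ax h => exact const (ax h)
  | linearity φ ψ => exact const (linearity φ ψ)
  | mp _ _ ih₁ ih₂ => exact mp (mp (ax (IPC.imp_distrib _ _ _)) ih₁) ih₂

theorem cut (h : Prov Γ φ) (h' : Prov (insert φ Γ) ψ) : Prov Γ ψ := h'.ded.mp h

theorem top_intro : Prov Γ top := ax IPC.top_intro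

theorem bot_elim (h : Prov Γ bot) : Prov Γ φ := mp (ax (IPC.bot_elim φ)) h

theorem and_intro (h : Prov Γ φ) (h' : Prov Γ ψ) : Prov Γ (and φ ψ) :=
  mp (mp (ax (IPC.and_intro φ ψ)) h) h'

theorem and_left (h : Prov Γ (and φ ψ)) : Prov Γ φ := mp (ax (IPC.and_left φ ψ)) h

theorem and_right (h : Prov Γ (and φ ψ)) : Prov Γ ψ := mp (ax (IPC.and_right φ ψ)) h

theorem or_inl (h : Prov Γ φ) : Prov Γ (or φ ψ) := mp (ax (IPC.or_inl φ ψ)) h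

theorem or_inr (h : Prov Γ ψ) : Prov Γ (or φ ψ) := mp (ax (IPC.or_inr φ ψ)) h

theorem or_elim (h : Prov Γ (or φ ψ)) (h₁ : Prov (insert φ Γ) χ) (h₂ : Prov (insert ψ Γ) χ) :
    Prov Γ χ :=
  mp (mp (mp (ax (IPC.or_elim φ ψ χ)) h₁.ded) h₂.ded) h

theorem linearity_cases (φ ψ : Formula α) (h₁ : Prov (insert (imp φ ψ) Γ) χ)
    (h₂ : Prov (insert (imp ψ φ) Γ) χ) : Prov Γ χ :=
  or_elim (linearity φ ψ) h₁ h₂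

/-- Case distinction by the weak law of excluded middle. -/
theorem weak_em_cases (φ : Formula α) (h₁ : Prov (insert (imp φ bot) Γ) χ)
    (h₂ : Prov (insert (imp (imp φ bot) bot) Γ) χ) : Prov Γ χ := by
  -- φ → ¬φ yields ¬φ, and ¬φ → φ yields ¬¬φ.
  refine linearity_cases φ (imp φ bot) ?_ ?_
  · refine cut (φ := imp φ bot) (ded ?_) (h₁.mono (Set.insert_subset_insert (Set.subset_insert _ _)))
    exact mp (mp head.weaken head) head
  · refine cut (φ := imp (imp φ bot) bot) (ded ?_)
      (h₂.mono (Set.insert_subset_insert (Set.subset_insert _ _)))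
    exact mp head (mp head.weaken head)

/-- Provable equivalence over a set of hypotheses. -/
def Equiv (Γ : Set (Formula α)) (φ ψ : Formula α) : Prop :=
  Prov (insert φ Γ) ψ ∧ Prov (insert ψ Γ) φ

namespace Equiv

theorem refl : Equiv Γ φ φ := ⟨head, head⟩

theorem symm (h : Equiv Γ φ ψ) : Equiv Γ ψ φ := ⟨h.2, h.1⟩

theorem prov (h : Equiv Γ φ ψ) (h' : Prov Γ φ) : Prov Γ ψ := cut h' h.1

theorem weaken (h : Equiv Γ φ ψ) : Equiv (insert χ Γ) φ ψ :=
  ⟨h.1.mono (Set.insert_subset_insert (Set.subset_insert _ _)),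
    h.2.mono (Set.insert_subset_insert (Set.subset_insert _ _))⟩

theorem trans (h : Equiv Γ φ ψ) (h' : Equiv Γ ψ χ) : Equiv Γ φ χ :=
  ⟨h'.weaken.prov h.1, h.symm.weaken.prov h'.2⟩

theorem and_congr (h : Equiv Γ φ φ') (h' : Equiv Γ ψ ψ') : Equiv Γ (and φ ψ) (and φ' ψ') :=
  ⟨and_intro (h.weaken.prov head.and_left) (h'.weaken.prov head.and_right),
    and_intro (h.symm.weaken.prov head.and_left) (h'.symm.weaken.prov head.and_right)⟩

theorem or_congr (h : Equiv Γ φ φ') (h' : Equiv Γ ψ ψ') : Equiv Γ (or φ ψ) (or φ' ψ') :=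
  ⟨or_elim head (or_inl (h.weaken.weaken.prov head)) (or_inr (h'.weaken.weaken.prov head)),
    or_elim head (or_inl (h.symm.weaken.weaken.prov head))
      (or_inr (h'.symm.weaken.weaken.prov head))⟩

theorem imp_congr (h : Equiv Γ φ φ') (h' : Equiv Γ ψ ψ') : Equiv Γ (imp φ ψ) (imp φ' ψ') :=
  ⟨ded (h'.weaken.weaken.prov (mp head.weaken (h.symm.weaken.weaken.prov head))),
    ded (h'.symm.weaken.weaken.prov (mp head.weaken (h.weaken.weaken.prov head)))⟩

end Equiv

end Prov

/-- Classical truth under a two-valued valuation. -/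
def Formula.Holds (v : α → Prop) : Formula α → Prop
  | var x => v x
  | bot => False
  | top => True
  | and φ ψ => φ.Holds v ∧ ψ.Holds v
  | or φ ψ => φ.Holds v ∨ ψ.Holds v
  | imp φ ψ => φ.Holds v → ψ.Holds v

/-! ### Glivenko's theorem -/

open Prov

variable {Γ : Set (Formula α)} {φ : Formula α} {v : α → Prop}

theorem finite_vars (φ : Formula α) : φ.vars.Finite := by
  induction φ <;> simp_all [vars]

/-- If `Γ` decides the negation of every variable of `χ` according to `v`, then it decides the
negation of `χ`. -/
theorem prov_not_or_not_not (χ : Formula α)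
    (hv : ∀ x ∈ χ.vars, (v x → Prov Γ (imp (imp (var x) bot) bot)) ∧
      (¬ v x → Prov Γ (imp (var x) bot))) :
    (χ.Holds v → Prov Γ (imp (imp χ bot) bot)) ∧ (¬ χ.Holds v → Prov Γ (imp χ bot)) := by
  induction χ with
  | var x => exact hv x rfl
  | bot => exact ⟨fun h => h.elim, fun _ => imp_self⟩
  | top => exact ⟨fun _ => ded (mp head top_intro), fun h => (h trivial).elim⟩
  | and φ ψ ih₁ ih₂ =>
    obtain ⟨p₁, n₁⟩ := ih₁ fun x hx => hv x (Or.inl hx)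
    obtain ⟨p₂, n₂⟩ := ih₂ fun x hx => hv x (Or.inr hx)
    refine ⟨fun h => ?_, fun h => ?_⟩
    · refine ded (mp (p₁ h.1).weaken (ded (mp (p₂ h.2).weaken.weaken (ded ?_))))
      exact mp head.weaken.weaken (and_intro head.weaken head)
    · by_cases h₁ : φ.Holds v
      · exact ded (mp (n₂ fun h₂ => h ⟨h₁, h₂⟩).weaken head.and_right)
      · exact ded (mp (n₁ h₁).weaken head.and_left)
  | or φ ψ ih₁ ih₂ =>
    obtain ⟨p₁, n₁⟩ := ih₁ fun x hx => hv x (Or.inl hx)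
    obtain ⟨p₂, n₂⟩ := ih₂ fun x hx => hv x (Or.inr hx)
    refine ⟨fun h => ?_, fun h => ?_⟩
    · rcases h with h | h
      · exact ded (mp (p₁ h).weaken (ded (mp head.weaken head.or_inl)))
      · exact ded (mp (p₂ h).weaken (ded (mp head.weaken head.or_inr)))
    · exact ded (or_elim head (mp (n₁ fun h₁ => h (Or.inl h₁)).weaken.weaken head)
        (mp (n₂ fun h₂ => h (Or.inr h₂)).weaken.weaken head))
  | imp φ ψ ih₁ ih₂ =>
    obtain ⟨p₁, n₁⟩ := ih₁ fun x hx => hv x (Or.inl hx)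
    obtain ⟨p₂, n₂⟩ := ih₂ fun x hx => hv x (Or.inr hx)
    refine ⟨fun h => ?_, fun h => ?_⟩
    · by_cases h₁ : φ.Holds v
      · exact ded (mp (p₂ (h h₁)).weaken (ded (mp head.weaken head.const)))
      · exact ded (mp head (ded (bot_elim (mp (n₁ h₁).weaken.weaken head))))
    · obtain ⟨h₁, h₂⟩ := Classical.not_imp.mp h
      exact ded (mp (p₁ h₁).weaken (ded (mp (n₂ h₂).weaken.weaken (mp head.weaken head))))

/-- By weak excluded middle, for each variable at least one of ¬x, ¬¬x can be added without making χ
provable; `v` records the choices. -/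
theorem exists_not_prov_of_finite {χ : Formula α} {s : Set α} (hs : s.Finite) (h : ¬ Prov Γ χ) :
    ∃ (v : α → Prop) (Γ' : Set (Formula α)), Γ ⊆ Γ' ∧ ¬ Prov Γ' χ ∧
      ∀ x ∈ s, (v x → Prov Γ' (imp (imp (var x) bot) bot)) ∧
        (¬ v x → Prov Γ' (imp (var x) bot)) := by
  classical
  induction s, hs using Set.Finite.induction_on with
  | empty => exact ⟨fun _ => True, Γ, subset_rfl, h, fun _ hx => hx.elim⟩
  | @insert a s ha _ ih =>
    obtain ⟨v, Γ', hΓ, hχ, hv⟩ := ih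
    have hupd : ∀ (b : Prop), ∀ x ∈ s, (Function.update v a b x ↔ v x) := by
      rintro b x hx
      rw [Function.update_of_ne (ne_of_mem_of_not_mem hx ha)]
    by_cases h₁ : Prov (insert (imp (var a) bot) Γ') χ
    · have h₂ : ¬ Prov (insert (imp (imp (var a) bot) bot) Γ') χ :=
        fun h₂ => hχ (weak_em_cases _ h₁ h₂)
      refine ⟨Function.update v a True, _, hΓ.trans (Set.subset_insert _ _), h₂, ?_⟩
      rintro x (rfl | hx)
      · simpa using head
      · rw [hupd _ x hx]
        exact ⟨fun h => ((hv x hx).1 h).weaken, fun h => ((hv x hx).2 h).weaken⟩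
    · refine ⟨Function.update v a False, _, hΓ.trans (Set.subset_insert _ _), h₁, ?_⟩
      rintro x (rfl | hx)
      · simpa using head
      · rw [hupd _ x hx]
        exact ⟨fun h => ((hv x hx).1 h).weaken, fun h => ((hv x hx).2 h).weaken⟩

/-- Glivenko's theorem for negations: a classically unsatisfiable formula is refutable. -/
theorem prov_not_of_not_holds (h : ∀ v, ¬ φ.Holds v) : Prov Γ (imp φ bot) := by
  by_contra hφ
  obtain ⟨v, Γ', -, hn, hv⟩ := exists_not_prov_of_finite (finite_vars φ) hφ
  exact hn ((prov_not_or_not_not φ hv).2 (h v))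

/-! ### Projective unifiers -/

open Classical in
/-- The substitution that is a projective unifier of `φ` whenever `v` satisfies `φ`. -/
noncomputable def unifier (φ : Formula α) (v : α → Prop) (x : α) : Formula α :=
  if v x then imp φ (var x) else and (imp (imp φ bot) bot) (imp φ (var x))

theorem unifier_equiv_self (h : Prov Γ φ) (χ : Formula α) :
    Prov.Equiv Γ (χ.subst (unifier φ v)) χ := by
  induction χ with
  | var x =>
    by_cases hx : v x
    · simp only [subst, unifier, if_pos hx]
      exact ⟨mp head h.weaken, head.const⟩
    · simp only [subst, unifier, if_neg hx]
      exact ⟨mp head.and_right h.weaken,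
        and_intro (ded (mp head h.weaken.weaken)) head.const⟩
  | bot => exact .refl
  | top => exact .refl
  | and _ _ ih₁ ih₂ => exact ih₁.and_congr ih₂
  | or _ _ ih₁ ih₂ => exact ih₁.or_congr ih₂
  | imp _ _ ih₁ ih₂ => exact ih₁.imp_congr ih₂

/-- Given ¬¬φ, both forms of the unifier reduce to φ → x, and φ → (·) commutes with the connectives:
⊥ needs ¬¬φ, and ∨ needs linearity. -/
theorem unifier_equiv_imp (h : Prov Γ (imp (imp φ bot) bot)) (χ : Formula α) :
    Prov.Equiv Γ (χ.subst (unifier φ v)) (imp φ χ) := by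
  induction χ with
  | var x =>
    by_cases hx : v x
    · simp only [subst, unifier, if_pos hx]
      exact .refl
    · simp only [subst, unifier, if_neg hx]
      exact ⟨head.and_right, and_intro h.weaken head⟩
  | bot => exact ⟨bot_elim head, mp h.weaken head⟩
  | top => exact ⟨head.const, top_intro⟩
  | and _ _ ih₁ ih₂ =>
    exact (ih₁.and_congr ih₂).trans
      ⟨ded (and_intro (mp head.weaken.and_left head) (mp head.weaken.and_right head)),
        and_intro (ded (mp head.weaken head).and_left) (ded (mp head.weaken head).and_right)⟩
  | or a b ih₁ ih₂ =>
    refine (ih₁.or_congr ih₂).trans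
      ⟨ded (or_elim head.weaken (mp head head.weaken).or_inl (mp head head.weaken).or_inr), ?_⟩
    -- Under a → b the disjunction a ∨ b collapses to b, and symmetrically to a.
    refine linearity_cases a b (or_inr (ded ?_)) (or_inl (ded ?_))
    · exact or_elim (mp head.weaken.weaken head) (mp head.weaken.weaken head) head
    · exact or_elim (mp head.weaken.weaken head) head (mp head.weaken.weaken head)
  | imp _ _ ih₁ ih₂ =>
    exact (ih₁.imp_congr ih₂).trans
      ⟨ded (ded (mp (mp head.weaken.weaken head.const) head.weaken)),
        ded (ded (mp (mp head.weaken.weaken head) (mp head.weaken head)))⟩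

/-- Given ¬φ, the formula φ → x is provable and ¬¬φ refutable, so the unifier replaces each variable
by its truth value under `v`. -/
theorem unifier_decided (h : Prov Γ (imp φ bot)) (χ : Formula α) :
    (χ.Holds v → Prov Γ (χ.subst (unifier φ v))) ∧
      (¬ χ.Holds v → Prov Γ (imp (χ.subst (unifier φ v)) bot)) := by
  induction χ with
  | var x =>
    refine ⟨fun hx => ?_, fun hx => ?_⟩ <;> simp only [Holds] at hx
    · simp only [subst, unifier, if_pos hx]
      exact ded (mp h.weaken head).bot_elim
    · simp only [subst, unifier, if_neg hx]
      exact ded (mp head.and_left h.weaken)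
  | bot => exact ⟨fun h => h.elim, fun _ => imp_self⟩
  | top => exact ⟨fun _ => top_intro, fun h => (h trivial).elim⟩
  | and a b ih₁ ih₂ =>
    refine ⟨fun h => and_intro (ih₁.1 h.1) (ih₂.1 h.2), fun h => ?_⟩
    by_cases ha : a.Holds v
    · exact ded (mp (ih₂.2 fun hb => h ⟨ha, hb⟩).weaken head.and_right)
    · exact ded (mp (ih₁.2 ha).weaken head.and_left)
  | or a b ih₁ ih₂ =>
    refine ⟨fun h => h.elim (fun ha => (ih₁.1 ha).or_inl) (fun hb => (ih₂.1 hb).or_inr),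
      fun h => ?_⟩
    exact ded (or_elim head (mp (ih₁.2 fun ha => h (Or.inl ha)).weaken.weaken head)
      (mp (ih₂.2 fun hb => h (Or.inr hb)).weaken.weaken head))
  | imp a b ih₁ ih₂ =>
    refine ⟨fun h => ?_, fun h => ?_⟩
    · by_cases ha : a.Holds v
      · exact (ih₂.1 (h ha)).const
      · exact ded (mp (ih₁.2 ha).weaken head).bot_elim
    · obtain ⟨ha, hb⟩ := Classical.not_imp.mp h
      exact ded (mp (ih₂.2 hb).weaken (mp head (ih₁.1 ha).weaken))

/-- If `v` satisfies `χ` and `φ` entails `χ`, then `unifier φ v` unifies `χ`. -/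
theorem prov_subst_unifier {χ : Formula α} (hv : χ.Holds v) (h : Prov Γ (imp φ χ)) :
    Prov Γ (χ.subst (unifier φ v)) :=
  weak_em_cases φ ((unifier_decided head χ).1 hv)
    ((unifier_equiv_imp head χ).symm.prov h.weaken)

/-! ### Structural completeness and the corollary -/

theorem exists_conjunction {Δ : Set (Formula α)} (hΔ : Δ.Finite) :
    ∃ φ, Prov Δ φ ∧ ∀ δ ∈ Δ, Prov ∅ (imp φ δ) ∧ ∀ v, φ.Holds v → δ.Holds v := by
  induction Δ, hΔ using Set.Finite.induction_on with
  | empty => exact ⟨top, top_intro, fun _ h => h.elim⟩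
  | @insert a Δ _ _ ih =>
    obtain ⟨φ, h₁, h₂⟩ := ih
    refine ⟨and a φ, and_intro head h₁.weaken, ?_⟩
    rintro δ (rfl | hδ)
    · exact ⟨ded head.and_left, fun v h => h.1⟩
    · exact ⟨ded (mp (h₂ δ hδ).1.weaken head.and_right), fun v h => (h₂ δ hδ).2 v h.2⟩

/-- Structural completeness: a `Π₁`-rule all of whose instances preserve theoremhood in `LC`
belongs to `LC`. -/
theorem pi1_mem_LC_of_forall_subst [Nontrivial α] {Δ : Set (Formula α)} (hΔ : Δ.Finite)
    {ψ : Formula α}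
    (h : ∀ σ : α → Formula α, (∀ δ ∈ Δ, Rule.thm (δ.subst σ) ∈ LC) → Rule.thm (ψ.subst σ) ∈ LC) :
    Rule.pi1 Δ hΔ ψ ∈ LC := by
  obtain ⟨φ, hφ, hΔφ⟩ := exists_conjunction hΔ
  by_cases hsat : ∃ v, φ.Holds v
  · obtain ⟨v, hv⟩ := hsat
    have hψ := h (unifier φ v) fun δ hδ =>
      (prov_subst_unifier ((hΔφ δ hδ).2 v hv) (hΔφ δ hδ).1).pi1_mem_LC Set.finite_empty
    exact pi1_mp_mem_LC hΔ ((unifier_equiv_self hφ ψ).1.ded.pi1_mem_LC hΔ)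
      (isRuleSystem_LC.pi1_of_thm hΔ hψ)
  · exact ((prov_not_of_not_holds fun v hv => hsat ⟨v, hv⟩).mp hφ).bot_elim.pi1_mem_LC hΔ

theorem Admissible.hereditarilyAdmissible_LC [Nontrivial α] {ρ : Rule α} (h : Admissible LC ρ) :
    HereditarilyAdmissible LC ρ := by
  intro Δ hΔ ψ hψ
  have hS := isRuleSystem_oplus LC {ρ}
  -- Admissibility is applied to the instance σ(ψ), which remains to be derived in LC ⊕ ρ.
  refine pi1_mem_LC_of_forall_subst hΔ fun σ hσ => h _ ?_
  refine hS.pi1_cut Set.finite_empty _ (hS.pi1_subst hΔ hψ σ) ?_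
  rintro _ ⟨δ, hδ, rfl⟩
  exact subset_oplus_left _ _ (hσ δ hδ)

theorem HereditarilyAdmissible.admissible {S : Set (Rule α)} {ρ : Rule α}
    (h : HereditarilyAdmissible S ρ) : Admissible S ρ :=
  fun χ hχ => h ∅ Set.finite_empty χ hχ

end PiTwo

theorem mainTheorem6 {α : Type*} [Infinite α] (ρ : PiTwo.Rule α) :
    PiTwo.Admissible PiTwo.LC ρ ↔ PiTwo.HereditarilyAdmissible PiTwo.LC ρ :=
  ⟨fun h => h.hereditarilyAdmissible_LC, fun h => h.admissible⟩
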